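/- Let $S_n$ be the symmetric group on $[n]$, $s_i=(i,i{+}1)$, $\ell$ the length function, $R(w)$ the set of reduced words of $w\in S_n$, and $\circ$ the 0-Hecke product ($w\circ s_i=ws_i$ if $\ell(ws_i)>\ell(w)$ and $w\circ s_i=w$ otherwise; $s_i\circ w$ likewise). For a composition $\mu=(\mu_1,\dots,\mu_k)$ of $n$, of length $\ell(\mu)=k$, cut the one-line word of $\pi\in S_n$ into consecutive blocks of sizes $\mu_1,\dots,\mu_k$; $\pi$ is a $\mu$-involution, $\pi\in\mathcal I_\mu$, if the standardization of every block is an involution. For $\pi\in\mathcal I_\mu$ put $\pi\circ_\mu s_i=s_i\circ\pi$ if the values $i,i{+}1$ lie in different blocks, and $\pi\circ_\mu s_i=s_i\circ\pi\circ s_{m+r}$ if they lie in the same block $B$, where $m$ is the number of positions before $B$ and $i$ is the $r$-th smallest value of $B$. A word $(a_1,\dots,a_p)$ with $\pi=e\circ_\mu s_{a_1}\circ_\mu\cdots\circ_\mu s_{a_p}$ and $p$ minimal is a reduced $\mu$-word of $\pi$; $R_\mu(\pi)$ is the set of these. The set of atoms of $\pi$ is the set $\mathcal A_\mu(\pi)\subseteq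 S_n$ with $R_\mu(\pi)=\bigsqcup_{w\in\mathcal A_\mu(\pi)}R(w)$, and $\mathcal A_\mu^{-1}(\pi)=\{w^{-1}:w\in\mathcal A_\mu(\pi)\}$. A composition $\nu$ of $n$ refines $\mu$ if every partial sum $\mu_1+\dots+\mu_j$ is a partial sum of $\nu$. On a fixed $\mathcal I_\mu$ the Bruhat order is: $\sigma\le^\mu\pi$ iff every word in $R_\mu(\pi)$ has a subword in $R_\mu(\sigma)$. On the disjoint union $\bigsqcup_{\mu}\mathcal I_\mu$ over all compositions of $n$, the $\mu$-Bruhat order is the partial order generated by these orders together with the relations $\tau\le\pi$ for $\tau\in\mathcal I_\nu$, $\pi\in\mathcal I_\mu$ such that $\nu$ refines $\mu$, $\ell(\nu)=\ell(\mu)+1$ and $\mathcal A_\nu(\tau)\subseteq\mathcal A_\mu(\pi)$. Write $\lessdot^\mu$ for its cover relation. **Lemma and Corollary.** Let $\mu,\nu$ be compositions of $n$ such that $\nu$ refines $\mu$, and let $\pi\in\mathcal I_\mu$ and $\tau\in\mathcal I_\nu$. 1. Either $\mathcal A_\nu^{-1}(\tau)\subseteq\mathcal A_\mu^{-1}(\pi)$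 or $\mathcal A_\nu^{-1}(\tau)\cap\mathcal A_\mu^{-1}(\pi)=\varnothing$. 2. If $\ell(\nu)=\ell(\mu)+1$ and some $w\in\mathcal A_\nu(\tau)$ is also in $\mathcal A_\mu(\pi)$, then $\tau\lessdot^\mu\pi$. Moreover $\tau$ is also covered by $\pi$ in the partial order generated in the same way after the Bruhat order of each single $\mathcal I_\mu$ is reversed (so that the identity is the largest element of $\mathcal I_\mu$, as for inclusion of orbit closures). -/

import Mathlib

open Equiv

namespace MuInv

/-! Permutations in `S_n` are `Equiv.Perm (Fin n)`; positions, values and the indices of the simple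
transpositions are counted from `0`, so a letter is an element of `Fin (n - 1)`. -/

/-- The smaller of the two elements moved by the simple transposition `s_i`. -/
def lo {n : ℕ} (i : Fin (n - 1)) : Fin n := ⟨i.1, by have := i.2; omega⟩

/-- The larger of the two elements moved by the simple transposition `s_i`. -/
def hi {n : ℕ} (i : Fin (n - 1)) : Fin n := ⟨i.1 + 1, by have := i.2; omega⟩

/-- The simple transposition `s_i = (i, i+1)`. -/
def simple {n : ℕ} (i : Fin (n - 1)) : Perm (Fin n) := swap (lo i) (hi i)

/-- The product `s_{a_1} ⋯ s_{a_p}`. -/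
def wordProd {n : ℕ} (a : List (Fin (n - 1))) : Perm (Fin n) := (a.map simple).prod

/-- `a` is a reduced word for `w`, that is `a ∈ R(w)`. -/
def IsReducedWord {n : ℕ} (w : Perm (Fin n)) (a : List (Fin (n - 1))) : Prop :=
  wordProd a = w ∧ ∀ b : List (Fin (n - 1)), wordProd b = w → a.length ≤ b.length

/-- The 0-Hecke product `s_i ∘ w`: it is `s_i w` if the value `i` occurs before `i+1` in `w`
(equivalently if `s_i w > w`), and `w` otherwise. -/
def heckeLeft {n : ℕ} (i : Fin (n - 1)) (w : Perm (Fin n)) : Perm (Fin n) :=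
  if w⁻¹ (lo i) < w⁻¹ (hi i) then simple i * w else w

/-- The 0-Hecke product `w ∘ s_i`: it is `w s_i` if `w(i) < w(i+1)`
(equivalently if `w s_i > w`), and `w` otherwise. -/
def heckeRight {n : ℕ} (w : Perm (Fin n)) (i : Fin (n - 1)) : Perm (Fin n) :=
  if w (lo i) < w (hi i) then w * simple i else w

/-- `ν` refines `μ`: each partial sum of `μ` is a partial sum of `ν`. (`Composition.boundaries` is
the set of partial sums, with the empty sum `0` included for every composition.) -/
def Refines {n : ℕ} (ν μ : Composition n) : Prop := μ.boundaries ⊆ ν.boundaries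

/-- The standardization of a word: each letter is replaced by its relative value. -/
def std {n k : ℕ} (Q : Fin k → Fin n) (j : Fin k) : Fin k :=
  ⟨(Finset.univ.filter fun q => Q q < Q j).card, by
    have h : (Finset.univ.filter fun q => Q q < Q j) ⊂ Finset.univ := by
      rw [Finset.ssubset_univ_iff]
      intro h
      have := Finset.mem_univ j
      rw [← h] at this
      simp at this
    simpa using Finset.card_lt_card h⟩

/-- The `b`-th block of `(π, μ)`, as a word. -/
def block {n : ℕ} (μ : Composition n) (π : Perm (Fin n)) (b : Fin μ.length) :
    Fin (μ.blocksFun b) → Fin n :=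
  fun j => π (μ.embedding b j)

/-- `π` is a `μ`-involution: the standardization of each block is an involution. -/
def IsMuInvolution {n : ℕ} (μ : Composition n) (π : Perm (Fin n)) : Prop :=
  ∀ b : Fin μ.length, Function.Involutive (std (block μ π b))

/-- The index of the block of `(π, μ)` which contains the value `v`. -/
def blockOf {n : ℕ} (μ : Composition n) (π : Perm (Fin n)) (v : Fin n) : Fin μ.length :=
  μ.index (π⁻¹ v)

/-- The relative value `r_B(v)` of `v` in the block `B` of `(π, μ)` which contains it. -/
def relValue {n : ℕ} (μ : Composition n) (π : Perm (Fin n)) (v : Fin n) :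
    Fin (μ.blocksFun (blockOf μ π v)) :=
  std (block μ π (blockOf μ π v)) (μ.invEmbedding (π⁻¹ v))

theorem std_lt_std {n k : ℕ} (Q : Fin k → Fin n) {j j' : Fin k} (h : Q j < Q j') :
    std Q j < std Q j' := by
  change (Finset.univ.filter fun q => Q q < Q j).card <
    (Finset.univ.filter fun q => Q q < Q j').card
  apply Finset.card_lt_card
  refine ⟨fun q hq => ?_, fun hs => ?_⟩
  · simp only [Finset.mem_filter, Finset.mem_univ, true_and] at hq ⊢
    exact hq.trans h
  · have : j ∈ Finset.univ.filter fun q => Q q < Q j := hs (by simpa using h)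
    simp at this

theorem embedding_relValue_lt {n : ℕ} (μ : Composition n) (π : Perm (Fin n)) (i : Fin (n - 1))
    (h : blockOf μ π (lo i) = blockOf μ π (hi i)) :
    (μ.embedding (blockOf μ π (lo i)) (relValue μ π (lo i))).1 < n - 1 := by
  obtain ⟨j', hj'⟩ : π⁻¹ (hi i) ∈ Set.range (μ.embedding (blockOf μ π (lo i))) := by
    rw [Composition.mem_range_embedding_iff']
    exact h
  have h1 : std (block μ π (blockOf μ π (lo i))) (μ.invEmbedding (π⁻¹ (lo i))) <
      std (block μ π (blockOf μ π (lo i))) j' := by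
    apply std_lt_std
    have e1 : block μ π (blockOf μ π (lo i)) (μ.invEmbedding (π⁻¹ (lo i))) = lo i := by
      unfold block blockOf
      rw [Composition.embedding_comp_inv]
      simp
    have e2 : block μ π (blockOf μ π (lo i)) j' = hi i := by
      unfold block
      rw [hj']
      simp
    rw [e1, e2]
    simp [lo, hi, Fin.lt_def]
  have h2 := (μ.embedding (blockOf μ π (lo i))).strictMono h1
  have h3 := (μ.embedding (blockOf μ π (lo i))
    (std (block μ π (blockOf μ π (lo i))) j')).2
  have h4 := Fin.lt_def.1 h2
  unfold relValue
  omega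

/-- The action `π ∘_μ s_i`. If `i` and `i+1` lie in different blocks it is `s_i ∘ π`; if they lie in
the same block `B` it is `s_i ∘ π ∘ s_r`, where `s_r` exchanges the positions number `r_B(i)` and
`r_B(i) + 1` of the block `B` (so that `std(B)` becomes `s ∘ std(B) ∘ s` with `s = s_{r_B(i)}`). -/
def muAct {n : ℕ} (μ : Composition n) (π : Perm (Fin n)) (i : Fin (n - 1)) : Perm (Fin n) :=
  if h : blockOf μ π (lo i) = blockOf μ π (hi i) then
    heckeRight (heckeLeft i π)
      ⟨(μ.embedding (blockOf μ π (lo i)) (relValue μ π (lo i))).1, embedding_relValue_lt μ π i h⟩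
  else heckeLeft i π

/-- `a` is a `μ`-word for `π`: `π = e ∘_μ s_{a_1} ∘_μ ⋯ ∘_μ s_{a_p}`. -/
def IsMuWord {n : ℕ} (μ : Composition n) (π : Perm (Fin n)) (a : List (Fin (n - 1))) : Prop :=
  a.foldl (muAct μ) 1 = π

/-- `a` is a reduced `μ`-word for `π`, that is `a ∈ R_μ(π)`. -/
def IsReducedMuWord {n : ℕ} (μ : Composition n) (π : Perm (Fin n)) (a : List (Fin (n - 1))) :
    Prop :=
  IsMuWord μ π a ∧ ∀ b : List (Fin (n - 1)), IsMuWord μ π b → a.length ≤ b.length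

/-- The atoms `A_μ(π)`: the permutations whose reduced words make up `R_μ(π)`. -/
def atoms {n : ℕ} (μ : Composition n) (π : Perm (Fin n)) : Set (Perm (Fin n)) :=
  {w | ∃ a, IsReducedWord w a ∧ IsReducedMuWord μ π a}

/-- The inverse atoms `A_μ⁻¹(π)`. -/
def invAtoms {n : ℕ} (μ : Composition n) (π : Perm (Fin n)) : Set (Perm (Fin n)) :=
  {v | v⁻¹ ∈ atoms μ π}

/-- The Bruhat order of `I_μ` for a fixed `μ`: each reduced `μ`-word of `π` has a subword which is
a reduced `μ`-word of `σ`. -/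
def BruhatLE {n : ℕ} (μ : Composition n) (σ π : Perm (Fin n)) : Prop :=
  ∀ a, IsReducedMuWord μ π a → ∃ a', a'.Sublist a ∧ IsReducedMuWord μ σ a'

/-- The disjoint union of the sets `I_μ` over all compositions `μ` of `n`. -/
structure MuInvolution (n : ℕ) where
  comp : Composition n
  perm : Perm (Fin n)
  isMuInvolution : IsMuInvolution comp perm

/-- Comparison between strata: the composition of `τ` refines that of `π` and has one part more,
and each atom of `τ` is an atom of `π`. -/
def CrossStep {n : ℕ} (τ π : MuInvolution n) : Prop :=
  Refines τ.comp π.comp ∧ τ.comp.length = π.comp.length + 1 ∧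
    atoms τ.comp τ.perm ⊆ atoms π.comp π.perm

/-- The `μ`-Bruhat order on the disjoint union of the `I_μ`: the partial order generated by the
Bruhat orders of the single `I_μ` and by the comparisons between strata. -/
def MuBruhatLE {n : ℕ} : MuInvolution n → MuInvolution n → Prop :=
  Relation.ReflTransGen fun τ π =>
    (τ.comp = π.comp ∧ BruhatLE π.comp τ.perm π.perm) ∨ CrossStep τ π

/-- The combinatorial form of the order by inclusion of orbit closures, in which the identity of `I_μ` is the dense orbit of
its stratum: as `MuBruhatLE`, but with the Bruhat order of each single `I_μ` reversed. -/
def ClosureLE {n : ℕ} : MuInvolution n → MuInvolution n → Prop :=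
  Relation.ReflTransGen fun τ π =>
    (τ.comp = π.comp ∧ BruhatLE π.comp π.perm τ.perm) ∨ CrossStep τ π

/-- `x` is covered by `y` in the order `r`. -/
def IsCover {α : Type*} (r : α → α → Prop) (x y : α) : Prop :=
  r x y ∧ x ≠ y ∧ ∀ z, r x z → r z y → z = x ∨ z = y

end MuInv

/-! The proof describes `μ`-words through the 0-Hecke monoid of `S_n`. Since the left and the right
0-Hecke actions commute (`heckeLeft_heckeRight`), the left action of a word on a permutation depends
only on its 0-Hecke product, which gives an associative product `star` on permutations, written `∘`
below.

Let `f` be the monotone map that sends a position to its block in `μ`, and write a permutation as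
`v = x u` with `u` in the parabolic subgroup `{u | f ∘ u = f}` and `x` increasing on blocks. Put
`toInv f v = x (u ∘ u⁻¹)`. If `v` is the inverse of the 0-Hecke product of a word `a`, then
`toInv f v` is the `μ`-involution reached by `a` (`muAct_toInv`, `isMuWord_iff`): a letter either
changes at most `x`, or passes through `x` and acts on both sides of `u ∘ u⁻¹`. Every `μ`-involution
is a value of `toInv f` (`exists_toInv_eq`), and a reduced `μ`-word is a reduced word
(`IsReducedMuWord.isReducedWord`), so that no set of atoms is empty.

If `ν` refines `μ`, with block map `g`, write `v = x y u` with `x y` and `u` the two factors of `v`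
for `g`, and with `y u` the parabolic part of `v` for `f`. Then `toInv g v = x y (u ∘ u⁻¹)` and
`toInv f v = x (y ∘ u ∘ u⁻¹ ∘ y⁻¹)`, so that `toInv g v` determines `toInv f v`
(`toInv_eq_of_toInv_eq`). As all reduced words of the atoms of one element have the same length, a
common atom of `τ` and `π` makes every atom of `τ` an atom of `π` (`atoms_subset_of_mem`).

For the covers, let `rank` be the length of the reduced words of an element. Along both orders the
number of blocks weakly decreases, `rank` is monotone (in opposite directions for the two orders),
and two comparable elements that agree in both are equal; the last point uses that a reduced word
has only itself as a subword of the same length. A comparison between strata preserves `rank` and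
removes one block, so nothing lies strictly in between (`isCover_reflTransGen`). -/

open Equiv

namespace MuInv

/-! ### Simple transpositions and 0-Hecke products -/

section Simple

variable {n : ℕ}

theorem lo_lt_hi (i : Fin (n - 1)) : lo i < hi i := by simp [lo, hi, Fin.lt_def]

@[simp] theorem simple_lo (i : Fin (n - 1)) : simple i (lo i) = hi i := swap_apply_left _ _

@[simp] theorem simple_hi (i : Fin (n - 1)) : simple i (hi i) = lo i := swap_apply_right _ _

@[simp] theorem simple_inv (i : Fin (n - 1)) : (simple i)⁻¹ = simple i := swap_inv _ _

@[simp] theorem simple_mul_self (i : Fin (n - 1)) : simple i * simple i = 1 := swap_mul_self _ _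

@[simp] theorem simple_mul_simple_mul (i : Fin (n - 1)) (w : Perm (Fin n)) :
    simple i * (simple i * w) = w := by rw [← mul_assoc, simple_mul_self, one_mul]

theorem simple_lt_simple {i : Fin (n - 1)} {p q : Fin n} (hpq : p < q)
    (h : ¬(p = lo i ∧ q = hi i)) : simple i p < simple i q := by
  unfold simple
  rw [swap_apply_def, swap_apply_def]
  simp only [lo, hi, Fin.lt_def, Fin.ext_iff] at *
  split_ifs <;> first | omega | (simp only; omega)

theorem simple_lt_simple_iff {i : Fin (n - 1)} {p q : Fin n} (h : ¬(p = lo i ∧ q = hi i))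
    (h' : ¬(p = hi i ∧ q = lo i)) : simple i p < simple i q ↔ p < q := by
  refine ⟨fun hs => ?_, fun hs => simple_lt_simple hs h⟩
  rcases lt_trichotomy p q with hpq | rfl | hpq
  · exact hpq
  · exact absurd hs (lt_irrefl _)
  · exact absurd (simple_lt_simple hpq fun hh => h' hh.symm) hs.not_gt

theorem heckeLeft_of_lt {i : Fin (n - 1)} {w : Perm (Fin n)} (h : w⁻¹ (lo i) < w⁻¹ (hi i)) :
    heckeLeft i w = simple i * w := if_pos h

theorem heckeLeft_of_gt {i : Fin (n - 1)} {w : Perm (Fin n)} (h : w⁻¹ (hi i) < w⁻¹ (lo i)) :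
    heckeLeft i w = w := if_neg h.not_gt

theorem heckeRight_of_lt {i : Fin (n - 1)} {w : Perm (Fin n)} (h : w (lo i) < w (hi i)) :
    heckeRight w i = w * simple i := if_pos h

theorem heckeRight_of_gt {i : Fin (n - 1)} {w : Perm (Fin n)} (h : w (hi i) < w (lo i)) :
    heckeRight w i = w := if_neg h.not_gt

theorem heckeLeft_inv (i : Fin (n - 1)) (w : Perm (Fin n)) :
    (heckeLeft i w)⁻¹ = heckeRight w⁻¹ i := by
  unfold heckeLeft heckeRight
  split_ifs <;> simp

/-- The left and the right 0-Hecke actions commute; everything about the 0-Hecke monoid that is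
needed below comes from this fact. -/
theorem heckeLeft_heckeRight (i j : Fin (n - 1)) (w : Perm (Fin n)) :
    heckeLeft i (heckeRight w j) = heckeRight (heckeLeft i w) j := by
  by_cases h1 : w (lo j) = lo i ∧ w (hi j) = hi i
  · have e1 : w⁻¹ (lo i) = lo j := by rw [← h1.1]; simp
    have e2 : w⁻¹ (hi i) = hi j := by rw [← h1.2]; simp
    have hB : w (lo j) < w (hi j) := by rw [h1.1, h1.2]; exact lo_lt_hi i
    have hA : w⁻¹ (lo i) < w⁻¹ (hi i) := by rw [e1, e2]; exact lo_lt_hi j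
    rw [heckeRight_of_lt hB, heckeLeft_of_lt hA, heckeLeft_of_gt, heckeRight_of_gt]
    · unfold simple
      rw [← h1.1, ← h1.2, swap_apply_apply]
      simp
    · simpa [h1.1, h1.2] using lo_lt_hi i
    · rw [mul_inv_rev, simple_inv, Perm.mul_apply, Perm.mul_apply, e1, e2, simple_lo, simple_hi]
      exact lo_lt_hi j
  by_cases h2 : w (lo j) = hi i ∧ w (hi j) = lo i
  · have e1 : w⁻¹ (hi i) = lo j := by rw [← h2.1]; simp
    have e2 : w⁻¹ (lo i) = hi j := by rw [← h2.2]; simp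
    have hB : w (hi j) < w (lo j) := by rw [h2.1, h2.2]; exact lo_lt_hi i
    have hA : w⁻¹ (hi i) < w⁻¹ (lo i) := by rw [e1, e2]; exact lo_lt_hi j
    rw [heckeRight_of_gt hB, heckeLeft_of_gt hA, heckeRight_of_gt hB]
  -- Otherwise neither multiplication changes the condition that controls the other one.
  have hB : (simple i * w) (lo j) < (simple i * w) (hi j) ↔ w (lo j) < w (hi j) := by
    rw [Perm.mul_apply, Perm.mul_apply]
    exact simple_lt_simple_iff h1 h2
  have hA : (w * simple j)⁻¹ (lo i) < (w * simple j)⁻¹ (hi i) ↔ w⁻¹ (lo i) < w⁻¹ (hi i) := by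
    rw [mul_inv_rev, simple_inv, Perm.mul_apply, Perm.mul_apply]
    apply simple_lt_simple_iff
    · rintro ⟨h, h'⟩
      exact h1 ⟨by rw [← h]; simp, by rw [← h']; simp⟩
    · rintro ⟨h, h'⟩
      exact h2 ⟨by rw [← h']; simp, by rw [← h]; simp⟩
  unfold heckeLeft heckeRight
  by_cases hA' : w⁻¹ (lo i) < w⁻¹ (hi i) <;> by_cases hB' : w (lo j) < w (hi j)
  · rw [if_pos hB', if_pos hA', if_pos (hA.2 hA'), if_pos (hB.2 hB'), mul_assoc]
  · rw [if_neg hB', if_pos hA', if_neg (mt hB.1 hB')]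
  · rw [if_pos hB', if_neg hA', if_neg (mt hA.1 hA'), if_pos hB']
  · rw [if_neg hB', if_neg hA', if_neg hB']

end Simple

/-! ### Inversions and reduced words -/

section Inversions

variable {n : ℕ}

/-- The set of inversions of `v`, as pairs of positions. -/
def inversions (v : Perm (Fin n)) : Finset (Fin n × Fin n) :=
  Finset.univ.filter fun x => x.1 < x.2 ∧ v x.2 < v x.1

/-- The number of inversions of `v`. -/
def invNum (v : Perm (Fin n)) : ℕ := (inversions v).card

@[simp] theorem mem_inversions {v : Perm (Fin n)} {p q : Fin n} :
    (p, q) ∈ inversions v ↔ p < q ∧ v q < v p := by simp [inversions]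

@[simp] theorem invNum_one : invNum (1 : Perm (Fin n)) = 0 := by
  rw [invNum, Finset.card_eq_zero, Finset.eq_empty_iff_forall_notMem]
  rintro ⟨p, q⟩ h
  rw [mem_inversions] at h
  exact h.1.not_gt h.2

theorem invNum_inv (v : Perm (Fin n)) : invNum v⁻¹ = invNum v := by
  refine Finset.card_bij' (fun x _ => (v⁻¹ x.2, v⁻¹ x.1)) (fun x _ => (v x.2, v x.1)) ?_ ?_ ?_ ?_
  · rintro ⟨p, q⟩ h
    simpa using (mem_inversions.1 h).symm
  · rintro ⟨p, q⟩ h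
    simpa using (mem_inversions.1 h).symm
  · rintro ⟨p, q⟩ -
    simp
  · rintro ⟨p, q⟩ -
    simp

theorem invNum_simple_mul {i : Fin (n - 1)} {v : Perm (Fin n)} (h : v⁻¹ (lo i) < v⁻¹ (hi i)) :
    invNum (simple i * v) = invNum v + 1 := by
  have hnot : (v⁻¹ (lo i), v⁻¹ (hi i)) ∉ inversions v := by
    rw [mem_inversions]
    simpa using fun _ => (lo_lt_hi i).le
  rw [invNum, invNum, ← Finset.card_insert_of_notMem hnot]
  congr 1
  ext ⟨p, q⟩
  rw [Finset.mem_insert, mem_inversions, mem_inversions, Perm.mul_apply, Perm.mul_apply,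
    Prod.mk.injEq]
  by_cases h1 : v p = lo i ∧ v q = hi i
  · have e1 : p = v⁻¹ (lo i) := by rw [← h1.1]; simp
    have e2 : q = v⁻¹ (hi i) := by rw [← h1.2]; simp
    rw [h1.1, h1.2, simple_lo, simple_hi]
    rw [← e1, ← e2] at h ⊢
    simpa using ⟨h, lo_lt_hi i⟩
  have h1' : ¬(p = v⁻¹ (lo i) ∧ q = v⁻¹ (hi i)) := by
    rintro ⟨rfl, rfl⟩
    simp at h1
  by_cases h2 : v p = hi i ∧ v q = lo i
  · have e1 : p = v⁻¹ (hi i) := by rw [← h2.1]; simp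
    have e2 : q = v⁻¹ (lo i) := by rw [← h2.2]; simp
    have : ¬p < q := by rw [e1, e2]; exact h.not_gt
    tauto
  · rw [simple_lt_simple_iff (fun hh => h2 hh.symm) (fun hh => h1 hh.symm)]
    tauto

theorem lt_or_gt_inv (v : Perm (Fin n)) (i : Fin (n - 1)) :
    v⁻¹ (lo i) < v⁻¹ (hi i) ∨ v⁻¹ (hi i) < v⁻¹ (lo i) :=
  lt_or_gt_of_ne fun h => (lo_lt_hi i).ne (v⁻¹.injective h)

theorem invNum_simple_mul_of_gt {i : Fin (n - 1)} {v : Perm (Fin n)}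
    (h : v⁻¹ (hi i) < v⁻¹ (lo i)) : invNum (simple i * v) + 1 = invNum v := by
  have h' : (simple i * v)⁻¹ (lo i) < (simple i * v)⁻¹ (hi i) := by simpa using h
  simpa using (invNum_simple_mul h').symm

theorem exists_descent {v : Perm (Fin n)} (hv : v ≠ 1) :
    ∃ i : Fin (n - 1), v (hi i) < v (lo i) := by
  by_contra hcon
  push Not at hcon
  apply hv
  have hlt : ∀ i : Fin (n - 1), v (lo i) < v (hi i) := fun i =>
    lt_of_le_of_ne (hcon i) fun h => (lo_lt_hi i).ne (v.injective h)
  have hmono : StrictMono v := by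
    cases n with
    | zero => exact fun p => p.elim0
    | succ m => exact Fin.strictMono_iff_lt_succ.2 fun i => hlt i
  have := (hmono.range_inj strictMono_id).1 (by simp)
  ext p
  simp [this]

theorem comp_simple {β : Type*} {f : Fin n → β} {i : Fin (n - 1)} (h : f (lo i) = f (hi i)) :
    f ∘ simple i = f := by
  funext p
  simp only [Function.comp_apply, simple, swap_apply_def]
  split_ifs with h1 h2
  · rw [h1, h]
  · rw [h2, h]
  · rfl

theorem comp_inv {β : Type*} {f : Fin n → β} {u : Perm (Fin n)} (h : f ∘ u = f) :
    f ∘ ⇑u⁻¹ = f := by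
  funext p
  have := congrFun h (u⁻¹ p)
  simpa using this.symm

theorem comp_mul {β : Type*} {f : Fin n → β} {u v : Perm (Fin n)} (hu : f ∘ u = f)
    (hv : f ∘ v = f) : f ∘ ⇑(u * v) = f := by
  rw [Perm.coe_mul, ← Function.comp_assoc, hu, hv]

/-- A permutation `u` with `f ∘ u = f`, for a monotone `f`, lies in the parabolic subgroup of the
fibres of `f`, and is reached from `1` by length-increasing left multiplications by simple
transpositions of that subgroup. -/
theorem left_induction {β : Type*} [PartialOrder β] {f : Fin n → β} (hf : Monotone f)
    {P : Perm (Fin n) → Prop} (one : P 1)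
    (step : ∀ (u : Perm (Fin n)) i, f ∘ u = f → f (lo i) = f (hi i) →
      u⁻¹ (lo i) < u⁻¹ (hi i) → P u → P (simple i * u))
    (u : Perm (Fin n)) (hu : f ∘ u = f) : P u := by
  induction h : invNum u using Nat.strong_induction_on generalizing u with
  | _ k ih =>
    by_cases h1 : u = 1
    · rwa [h1]
    obtain ⟨i, hi'⟩ := exists_descent (v := u⁻¹) (by simpa using h1)
    have hfi : f (lo i) = f (hi i) := by
      have e := comp_inv hu
      refine le_antisymm (hf (lo_lt_hi i).le) ?_
      have := hf hi'.le
      rwa [← Function.comp_apply (f := f), ← Function.comp_apply (f := f) (x := lo i), e] at this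
    have hu' : f ∘ ⇑(simple i * u) = f := comp_mul (comp_simple hfi) hu
    have := step (simple i * u) i hu' hfi (by simpa using hi')
      (ih _ (by have := invNum_simple_mul_of_gt hi'; omega) _ hu' rfl)
    simpa using this

theorem right_induction {β : Type*} [PartialOrder β] {f : Fin n → β} (hf : Monotone f)
    {P : Perm (Fin n) → Prop} (one : P 1)
    (step : ∀ (u : Perm (Fin n)) i, f ∘ u = f → f (lo i) = f (hi i) →
      u (lo i) < u (hi i) → P u → P (u * simple i)) (u : Perm (Fin n)) (hu : f ∘ u = f) : P u := by
  have := left_induction hf (P := fun w => P w⁻¹) (by simpa using one)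
    (fun w i hw hi' hlt hP => by
      simpa using step w⁻¹ i (comp_inv hw) hi' hlt hP) u⁻¹ (comp_inv hu)
  simpa using this

/-- The result of letting the letters of `a` act one after the other on `w` by left 0-Hecke
products. For `w = 1` it is the inverse of the 0-Hecke product of the word `a`. -/
def leftFold (a : List (Fin (n - 1))) (w : Perm (Fin n)) : Perm (Fin n) :=
  a.foldl (fun v i => heckeLeft i v) w

@[simp] theorem leftFold_nil (w : Perm (Fin n)) : leftFold [] w = w := rfl

@[simp] theorem leftFold_concat (a : List (Fin (n - 1))) (i : Fin (n - 1)) (w : Perm (Fin n)) :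
    leftFold (a ++ [i]) w = heckeLeft i (leftFold a w) := by simp [leftFold]

theorem wordProd_concat_inv (a : List (Fin (n - 1))) (i : Fin (n - 1)) :
    (wordProd (a ++ [i]))⁻¹ = simple i * (wordProd a)⁻¹ := by simp [wordProd]

theorem exists_leftFold (v : Perm (Fin n)) :
    ∃ a, leftFold a 1 = v ∧ a.length = invNum v ∧ wordProd a = v⁻¹ := by
  refine left_induction (f := fun _ => ()) (fun _ _ _ => le_rfl)
    (P := fun v => ∃ a, leftFold a 1 = v ∧ a.length = invNum v ∧ wordProd a = v⁻¹)
    ⟨[], by simp [wordProd]⟩ ?_ v rfl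
  rintro u i - - hlt ⟨a, h1, h2, h3⟩
  refine ⟨a ++ [i], ?_, ?_, ?_⟩
  · rw [leftFold_concat, h1, heckeLeft_of_lt hlt]
  · rw [invNum_simple_mul hlt, ← h2]
    simp
  · rw [← inv_inj, wordProd_concat_inv, h3]
    simp

theorem invNum_simple_mul_le (i : Fin (n - 1)) (v : Perm (Fin n)) :
    invNum (simple i * v) ≤ invNum v + 1 := by
  rcases lt_or_gt_inv v i with h | h
  · exact (invNum_simple_mul h).le
  · have := invNum_simple_mul_of_gt h
    omega

theorem invNum_wordProd_le (a : List (Fin (n - 1))) : invNum (wordProd a)⁻¹ ≤ a.length := by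
  induction a using List.reverseRecOn with
  | nil => simp [wordProd]
  | append_singleton a i ih =>
    rw [wordProd_concat_inv]
    have := invNum_simple_mul_le i (wordProd a)⁻¹
    simp
    omega

theorem isReducedWord_iff {w : Perm (Fin n)} {a : List (Fin (n - 1))} :
    IsReducedWord w a ↔ wordProd a = w ∧ a.length = invNum w⁻¹ := by
  constructor
  · rintro ⟨h, hmin⟩
    obtain ⟨b, -, hb, hb'⟩ := exists_leftFold w⁻¹
    refine ⟨h, le_antisymm ?_ ?_⟩
    · rw [← hb]
      exact hmin b (by rw [hb', inv_inv])
    · rw [← h]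
      exact invNum_wordProd_le a
  · rintro ⟨h, hlen⟩
    refine ⟨h, fun b hb => ?_⟩
    rw [hlen, ← hb]
    exact invNum_wordProd_le b

theorem leftFold_of_length_eq {a : List (Fin (n - 1))} (h : a.length = invNum (wordProd a)⁻¹) :
    leftFold a 1 = (wordProd a)⁻¹ := by
  induction a using List.reverseRecOn with
  | nil => simp [wordProd]
  | append_singleton a i ih =>
    rw [wordProd_concat_inv] at h ⊢
    have h1 := invNum_simple_mul_le i (wordProd a)⁻¹
    have h2 := invNum_wordProd_le a
    rw [List.length_append, List.length_singleton] at h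
    rw [leftFold_concat, ih (by omega)]
    rcases lt_or_gt_inv (wordProd a)⁻¹ i with hlt | hlt
    · exact heckeLeft_of_lt hlt
    · have := invNum_simple_mul_of_gt hlt
      omega

theorem IsReducedWord.leftFold_eq {w : Perm (Fin n)} {a : List (Fin (n - 1))}
    (h : IsReducedWord w a) : leftFold a 1 = w⁻¹ := by
  obtain ⟨rfl, h⟩ := isReducedWord_iff.1 h
  exact leftFold_of_length_eq h

theorem invNum_leftFold_le (a : List (Fin (n - 1))) : invNum (leftFold a 1) ≤ a.length := by
  induction a using List.reverseRecOn with
  | nil => simp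
  | append_singleton a i ih =>
    rw [leftFold_concat, List.length_append, List.length_singleton]
    rcases lt_or_gt_inv (leftFold a 1) i with h | h
    · rw [heckeLeft_of_lt h, invNum_simple_mul h]
      omega
    · rw [heckeLeft_of_gt h]
      omega

theorem leftFold_of_invNum_eq {a : List (Fin (n - 1))} (h : invNum (leftFold a 1) = a.length) :
    leftFold a 1 = (wordProd a)⁻¹ := by
  induction a using List.reverseRecOn with
  | nil => simp [wordProd]
  | append_singleton a i ih =>
    have hle := invNum_leftFold_le a
    rw [leftFold_concat, List.length_append, List.length_singleton] at h
    rw [leftFold_concat, wordProd_concat_inv]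
    rcases lt_or_gt_inv (leftFold a 1) i with hlt | hlt
    · rw [heckeLeft_of_lt hlt, invNum_simple_mul hlt] at h
      rw [heckeLeft_of_lt hlt, ih (by omega)]
    · rw [heckeLeft_of_gt hlt] at h
      omega

end Inversions


/-! ### The 0-Hecke monoid -/

section Star

variable {n : ℕ}

theorem leftFold_heckeRight (a : List (Fin (n - 1))) (w : Perm (Fin n)) (j : Fin (n - 1)) :
    leftFold a (heckeRight w j) = heckeRight (leftFold a w) j := by
  induction a using List.reverseRecOn with
  | nil => rfl
  | append_singleton a i ih => rw [leftFold_concat, leftFold_concat, ih, heckeLeft_heckeRight]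

/-- The result of acting on `w` from the left depends on the word only through the result of its
action on `1`: write `w` as a right 0-Hecke product, and use that the two actions commute. -/
theorem leftFold_congr {a b : List (Fin (n - 1))} (h : leftFold a 1 = leftFold b 1)
    (w : Perm (Fin n)) : leftFold a w = leftFold b w := by
  refine right_induction (f := fun _ => ()) (fun _ _ _ => le_rfl)
    (P := fun w => leftFold a w = leftFold b w) h ?_ w rfl
  intro u i _ _ hlt ih
  rw [← heckeRight_of_lt hlt, leftFold_heckeRight, leftFold_heckeRight, ih]

/-- The 0-Hecke (Demazure) product of two permutations: a word for `v` acts on `w` by left 0-Hecke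
products. By `leftFold_congr` the choice of the word does not matter. -/
noncomputable def star (v w : Perm (Fin n)) : Perm (Fin n) :=
  leftFold (exists_leftFold v).choose w

theorem star_leftFold (a : List (Fin (n - 1))) (w : Perm (Fin n)) :
    star (leftFold a 1) w = leftFold a w :=
  leftFold_congr (exists_leftFold (leftFold a 1)).choose_spec.1 w

@[simp] theorem star_one_left (w : Perm (Fin n)) : star 1 w = w := star_leftFold [] w

@[simp] theorem star_one_right (v : Perm (Fin n)) : star v 1 = v :=
  (exists_leftFold v).choose_spec.1

theorem star_heckeLeft (i : Fin (n - 1)) (v w : Perm (Fin n)) :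
    star (heckeLeft i v) w = heckeLeft i (star v w) := by
  obtain ⟨a, rfl, -⟩ := exists_leftFold v
  rw [← leftFold_concat, star_leftFold, star_leftFold, leftFold_concat]

theorem star_heckeRight (v w : Perm (Fin n)) (j : Fin (n - 1)) :
    star v (heckeRight w j) = heckeRight (star v w) j :=
  leftFold_heckeRight _ _ _

theorem heckeLeft_induction {P : Perm (Fin n) → Prop} (one : P 1)
    (step : ∀ i u, P u → P (heckeLeft i u)) (u : Perm (Fin n)) : P u := by
  refine left_induction (f := fun _ => ()) (fun _ _ _ => le_rfl) one ?_ u rfl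
  intro u i _ _ hlt ih
  rw [← heckeLeft_of_lt hlt]
  exact step i u ih

theorem star_assoc (u v w : Perm (Fin n)) : star (star u v) w = star u (star v w) := by
  induction u using heckeLeft_induction with
  | one => simp
  | step i u ih => rw [star_heckeLeft, star_heckeLeft, star_heckeLeft, ih]

theorem star_inv (v w : Perm (Fin n)) : (star v w)⁻¹ = star w⁻¹ v⁻¹ := by
  induction v using heckeLeft_induction with
  | one => simp
  | step i u ih => rw [star_heckeLeft, heckeLeft_inv, heckeLeft_inv, star_heckeRight, ih]

end Star

/-! ### Parabolic decompositions -/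

section Parabolic

variable {n : ℕ} {β : Type*} {f : Fin n → β}

/-- `x` is increasing on each fibre of `f`. For a monotone `f` this says that `x` is the
representative of minimal length of its left coset modulo the parabolic subgroup
`{u | f ∘ u = f}`. -/
def IncreasingOn (f : Fin n → β) (x : Perm (Fin n)) : Prop :=
  ∀ p q, f p = f q → p < q → x p < x q

theorem IncreasingOn.lt_iff {x : Perm (Fin n)} (hx : IncreasingOn f x) {p q : Fin n}
    (h : f p = f q) : x p < x q ↔ p < q := by
  refine ⟨fun hlt => ?_, hx p q h⟩
  rcases lt_trichotomy p q with hpq | rfl | hpq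
  · exact hpq
  · exact absurd hlt (lt_irrefl _)
  · exact absurd (hx q p h.symm hpq) hlt.not_gt

theorem comp_heckeLeft {i : Fin (n - 1)} {w : Perm (Fin n)} (hi : f (lo i) = f (hi i))
    (hw : f ∘ w = f) : f ∘ heckeLeft i w = f := by
  unfold heckeLeft
  split_ifs
  · exact comp_mul (comp_simple hi) hw
  · exact hw

variable [LinearOrder β]

/-- The parabolic part of `w`: the standardization of the word `p ↦ (f p, w p)` in lexicographic
order. For a monotone `f` it standardizes the restriction of `w` to every fibre of `f`. -/
noncomputable def parab (f : Fin n → β) (w : Perm (Fin n)) : Perm (Fin n) :=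
  (Tuple.sort fun p => toLex (f p, w p))⁻¹

/-- `parab f w` is the only map `Fin n → Fin n` that preserves the lexicographic order of the pairs
`(f p, w p)`. -/
theorem eq_parab {w : Perm (Fin n)} {P : Fin n → Fin n}
    (h1 : ∀ p q, f p < f q → P p < P q) (h2 : ∀ p q, f p = f q → w p < w q → P p < P q) :
    P = parab f w := by
  set g : Fin n → β ×ₗ Fin n := fun p => toLex (f p, w p) with hg
  have hmono : StrictMono (P ∘ Tuple.sort g) := by
    intro p q hpq
    have hle : g (Tuple.sort g p) ≤ g (Tuple.sort g q) := Tuple.monotone_sort g hpq.le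
    rcases Prod.Lex.le_iff.1 hle with h | ⟨h, h'⟩
    · exact h1 _ _ h
    · exact h2 _ _ h (lt_of_le_of_ne h' fun e =>
        hpq.ne ((Tuple.sort g).injective (w.injective e)))
  have hid : P ∘ Tuple.sort g = id := by
    refine (hmono.range_inj strictMono_id).1 ?_
    rw [Set.range_id]
    exact (Finite.injective_iff_surjective.1 hmono.injective).range_eq
  funext p
  have := congrFun hid ((Tuple.sort g)⁻¹ p)
  simpa [parab, ← hg] using this

theorem parab_lt_of_lt {w : Perm (Fin n)} {p q : Fin n}
    (h : toLex (f p, w p) < toLex (f q, w q)) : parab f w p < parab f w q := by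
  by_contra hcon
  have := Tuple.monotone_sort (fun p => toLex (f p, w p)) (not_lt.1 hcon)
  simp only [Function.comp_apply, parab, Perm.inv_def, apply_symm_apply] at this
  exact this.not_gt h

theorem comp_parab (hf : Monotone f) (w : Perm (Fin n)) : f ∘ parab f w = f := by
  have h : Monotone (f ∘ Tuple.sort fun p => toLex (f p, w p)) := fun p q hpq => by
    rcases Prod.Lex.le_iff.1 (Tuple.monotone_sort (fun p => toLex (f p, w p)) hpq) with h | ⟨h, -⟩
    · exact le_of_lt h
    · exact le_of_eq h
  exact comp_inv (Tuple.unique_monotone h (τ := 1) hf)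

theorem parab_mul (hf : Monotone f) {x u : Perm (Fin n)} (hx : IncreasingOn f x)
    (hu : f ∘ u = f) : parab f (x * u) = u := by
  have hu' : ∀ p, f (u p) = f p := congrFun hu
  symm
  apply DFunLike.coe_injective
  apply eq_parab
  · intro p q h
    rw [← hu' p, ← hu' q] at h
    exact hf.reflect_lt h
  · intro p q h hlt
    exact (hx.lt_iff (by rw [hu', hu', h])).1 hlt

theorem increasingOn_mul_parab_inv (hf : Monotone f) (w : Perm (Fin n)) :
    IncreasingOn f (w * (parab f w)⁻¹) := by
  intro p q h hpq
  have hu : ∀ p, f ((parab f w)⁻¹ p) = f p := congrFun (comp_inv (comp_parab hf w))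
  rw [Perm.mul_apply, Perm.mul_apply]
  by_contra hcon
  have hne : w ((parab f w)⁻¹ q) ≠ w ((parab f w)⁻¹ p) := by simpa using hpq.ne'
  have := parab_lt_of_lt (f := f) (w := w) (p := (parab f w)⁻¹ q) (q := (parab f w)⁻¹ p)
    (Prod.Lex.lt_iff.2 (Or.inr ⟨by simp only [ofLex_toLex, hu, h],
      lt_of_le_of_ne (not_lt.1 hcon) hne⟩))
  simp only [Perm.inv_def, apply_symm_apply] at this
  exact this.not_gt hpq

theorem exists_eq_mul (hf : Monotone f) (w : Perm (Fin n)) :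
    ∃ x u, w = x * u ∧ IncreasingOn f x ∧ f ∘ u = f :=
  ⟨_, parab f w, by simp, increasingOn_mul_parab_inv hf w, comp_parab hf w⟩

theorem star_eq_mul (hf : Monotone f) {x u : Perm (Fin n)} (hx : IncreasingOn f x)
    (hu : f ∘ u = f) : star x u = x * u := by
  refine right_induction hf (P := fun u => star x u = x * u) (by simp) ?_ u hu
  intro u i hu hfi hlt ih
  have : (x * u) (lo i) < (x * u) (hi i) := by
    rw [Perm.mul_apply, Perm.mul_apply, hx.lt_iff]
    · exact hlt
    · rw [← Function.comp_apply (f := f), hu, hfi, ← Function.comp_apply (f := f) (g := u), hu]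
  rw [← heckeRight_of_lt hlt, star_heckeRight, ih, heckeRight_of_lt this, heckeRight_of_lt hlt,
    mul_assoc]

theorem comp_star (hf : Monotone f) {u w : Perm (Fin n)} (hu : f ∘ u = f) (hw : f ∘ w = f) :
    f ∘ star u w = f := by
  refine left_induction hf (P := fun u => f ∘ star u w = f) (by simpa using hw) ?_ u hu
  intro u i _ hi hlt ih
  rw [← heckeLeft_of_lt hlt, star_heckeLeft]
  exact comp_heckeLeft hi ih

theorem star_mul (hf : Monotone f) {x u w : Perm (Fin n)} (hx : IncreasingOn f x)
    (hu : f ∘ u = f) (hw : f ∘ w = f) : star (x * u) w = x * star u w := by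
  rw [← star_eq_mul hf hx hu, star_assoc, star_eq_mul hf hx (comp_star hf hu hw)]

/-- For `v = x u` with `x` a minimal coset representative and `u` in the parabolic subgroup of `f`,
this is `x (u ∘ u⁻¹)` (see `toInv_mul`). When the fibres of `f` are the blocks of `μ`, it is the
`μ`-involution reached from `1` by the words whose 0-Hecke product is `v⁻¹`. -/
noncomputable def toInv (f : Fin n → β) (v : Perm (Fin n)) : Perm (Fin n) :=
  star v (parab f v)⁻¹

theorem toInv_mul (hf : Monotone f) {x u : Perm (Fin n)} (hx : IncreasingOn f x)
    (hu : f ∘ u = f) : toInv f (x * u) = x * star u u⁻¹ := by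
  rw [toInv, parab_mul hf hx hu, star_mul hf hx hu (comp_inv hu)]

/-- `toInv` for the blocks of `μ` factors through `toInv` for the blocks of a refinement of `μ`:
with `v = x y u`, where `u` is the parabolic part of `v` for `g` and `y u` that for `f`, one has
`toInv g v = x y (u ∘ u⁻¹)` and `toInv f v = x (y ∘ u ∘ u⁻¹ ∘ y⁻¹)`. -/
theorem toInv_eq_of_toInv_eq {γ : Type*} [LinearOrder γ] {g : Fin n → γ} (hf : Monotone f)
    (hg : Monotone g) (hfg : ∀ p q, g p = g q → f p = f q) {v w : Perm (Fin n)}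
    (h : toInv g v = toInv g w) : toInv f v = toInv f w := by
  suffices H : ∀ v, toInv f v = star (toInv g v)
      (parab f (toInv g v * (parab g (toInv g v))⁻¹))⁻¹ by rw [H v, H w, h]
  clear h v w
  intro v
  obtain ⟨x, u, rfl, hx, hu⟩ := exists_eq_mul hg v
  obtain ⟨x', y, rfl, hx', hy⟩ := exists_eq_mul hf x
  have hz := comp_star hg hu (comp_inv hu)
  have e1 : toInv g (x' * y * u) * (parab g (toInv g (x' * y * u)))⁻¹ = x' * y := by
    rw [toInv_mul hg hx hu, parab_mul hg hx hz]
    group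
  have hfu : f ∘ u = f := funext fun p => hfg _ _ (congrFun hu p)
  have hyg : IncreasingOn g y := by
    intro p q hpq hlt
    refine (hx'.lt_iff ?_).1 (hx p q hpq hlt)
    rw [← Function.comp_apply (f := f), ← Function.comp_apply (f := f) (g := y) (x := q), hy]
    exact hfg p q hpq
  rw [e1, parab_mul hf hx' hy, toInv, toInv, parab_mul hg hx hu, mul_assoc,
    parab_mul hf hx' (comp_mul hy hfu), ← star_eq_mul hg hyg hu, star_inv, ← star_assoc]

end Parabolic


/-! ### The action of simple transpositions on `μ`-involutions -/

section ToInv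

variable {n : ℕ} {β : Type*} [LinearOrder β] {f : Fin n → β}

theorem toInv_one (hf : Monotone f) : toInv f 1 = 1 := by
  have h := toInv_mul hf (x := 1) (u := 1) (fun _ _ _ h => h) rfl
  simpa using h

theorem apply_toInv_inv (hf : Monotone f) (v : Perm (Fin n)) (k : Fin n) :
    f ((toInv f v)⁻¹ k) = f (v⁻¹ k) := by
  obtain ⟨x, u, rfl, hx, hu⟩ := exists_eq_mul hf v
  rw [toInv_mul hf hx hu, mul_inv_rev, mul_inv_rev]
  exact (congrFun (comp_inv (comp_star hf hu (comp_inv hu))) (x⁻¹ k)).trans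
    (congrFun (comp_inv hu) (x⁻¹ k)).symm

theorem toInv_heckeLeft_of_ne {v : Perm (Fin n)} {i : Fin (n - 1)}
    (h : f (v⁻¹ (lo i)) ≠ f (v⁻¹ (hi i))) :
    toInv f (heckeLeft i v) = heckeLeft i (toInv f v) := by
  have hp : parab f (heckeLeft i v) = parab f v := by
    unfold heckeLeft
    split_ifs
    · symm
      apply DFunLike.coe_injective
      apply eq_parab
      · exact fun p q hpq => parab_lt_of_lt (Prod.Lex.lt_iff.2 (Or.inl hpq))
      · intro p q hpq hlt
        refine parab_lt_of_lt (Prod.Lex.lt_iff.2 (Or.inr ⟨hpq, ?_⟩))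
        refine (simple_lt_simple_iff (i := i) ?_ ?_).1 hlt
        · rintro ⟨h1, h2⟩
          apply h
          rw [← h1, ← h2]
          simpa using hpq
        · rintro ⟨h1, h2⟩
          apply h
          rw [← h1, ← h2]
          simpa using hpq.symm
    · rfl
  rw [toInv, hp, star_heckeLeft, toInv]

/-- If the values `i`, `i + 1` of `v` lie in the same fibre of `f`, then in the minimal coset
representative of `v` they sit in consecutive positions. So `s_i` moves past this representative
and acts on the parabolic part `u` of `v`, and hence on both sides of `u ∘ u⁻¹`. -/
theorem toInv_heckeLeft_of_eq (hf : Monotone f) {v : Perm (Fin n)} {i j : Fin (n - 1)}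
    (h : f (v⁻¹ (lo i)) = f (v⁻¹ (hi i)))
    (hj : lo j = parab f (toInv f v) ((toInv f v)⁻¹ (lo i))) :
    toInv f (heckeLeft i v) = heckeRight (heckeLeft i (toInv f v)) j := by
  obtain ⟨x, u, rfl, hx, hu⟩ := exists_eq_mul hf v
  have hxu : ∀ k, f ((x * u)⁻¹ k) = f (x⁻¹ k) := fun k => by
    rw [mul_inv_rev]
    exact congrFun (comp_inv hu) (x⁻¹ k)
  rw [hxu, hxu] at h
  have hlo : lo j = x⁻¹ (lo i) := by
    rw [hj, toInv_mul hf hx hu, parab_mul hf hx (comp_star hf hu (comp_inv hu))]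
    simp
  have hlt : x⁻¹ (lo i) < x⁻¹ (hi i) :=
    (hx.lt_iff h).1 (by simpa using lo_lt_hi i)
  -- A position strictly between the two would carry a value strictly between `i` and `i + 1`.
  have hhi : hi j = x⁻¹ (hi i) := by
    by_contra hne
    have hle : hi j ≤ x⁻¹ (hi i) := by
      rw [← hlo, Fin.lt_def] at hlt
      rw [Fin.le_def]
      exact hlt
    have hlt2 := lt_of_le_of_ne hle hne
    have hlt1 : x⁻¹ (lo i) < hi j := hlo ▸ lo_lt_hi j
    have hfj : f (x⁻¹ (lo i)) = f (hi j) :=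
      le_antisymm (hf hlt1.le) (h ▸ hf hle)
    have v1 := hx _ _ hfj hlt1
    have v2 := hx _ _ (hfj.symm.trans h) hlt2
    rw [Perm.inv_def, apply_symm_apply, Fin.lt_def] at v1 v2
    simp only [lo, hi] at v1 v2
    omega
  have hs : simple i * x = x * simple j := by
    rw [simple, simple, hlo, hhi, swap_apply_apply]
    group
  have hfj : f (lo j) = f (hi j) := by rw [hlo, hhi, h]
  have hL : heckeLeft i (x * u) = x * heckeLeft j u := by
    unfold heckeLeft
    rw [mul_inv_rev, Perm.mul_apply, Perm.mul_apply, ← hlo, ← hhi]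
    split_ifs
    · rw [← mul_assoc, hs, mul_assoc]
    · rfl
  have hp : parab f (heckeLeft i (x * u)) = heckeLeft j u := by
    rw [hL, parab_mul hf hx (comp_heckeLeft hfj hu)]
  rw [toInv, hp, heckeLeft_inv, star_heckeRight, star_heckeLeft, toInv, parab_mul hf hx hu]

/-- Every involution of a parabolic subgroup has the form `u ∘ u⁻¹`: if `s = s_i` is a descent of
the involution `z`, then `z` is `s ∘ z' ∘ s` for the shorter involution `z' = s z s`, or `z' = s z`
when `s` and `z` commute. -/
theorem exists_star_inv_eq (hf : Monotone f) (z : Perm (Fin n)) (hz : f ∘ z = f)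
    (hinv : z⁻¹ = z) : ∃ u : Perm (Fin n), f ∘ u = f ∧ star u u⁻¹ = z := by
  induction h : invNum z using Nat.strong_induction_on generalizing z with
  | _ k ih =>
    by_cases h1 : z = 1
    · exact ⟨1, rfl, by simp [h1]⟩
    obtain ⟨i, hdesc⟩ := exists_descent h1
    have hfi : f (lo i) = f (hi i) := by
      refine le_antisymm (hf (lo_lt_hi i).le) ?_
      have := hf hdesc.le
      rwa [← Function.comp_apply (f := f), ← Function.comp_apply (f := f) (x := lo i), hz] at this
    have hdesc' : z⁻¹ (hi i) < z⁻¹ (lo i) := by rwa [hinv]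
    have hN := invNum_simple_mul_of_gt hdesc'
    have hfs := comp_simple hfi
    suffices H : ∃ z' : Perm (Fin n), f ∘ z' = f ∧ z'⁻¹ = z' ∧ invNum z' < invNum z ∧
        heckeRight (heckeLeft i z') i = z by
      obtain ⟨z', hz', hinv', hlt, heq⟩ := H
      obtain ⟨u, hu, hu'⟩ := ih _ (h ▸ hlt) z' hz' hinv' rfl
      refine ⟨heckeLeft i u, comp_heckeLeft hfi hu, ?_⟩
      rw [heckeLeft_inv, star_heckeRight, star_heckeLeft, hu', heq]
    by_cases hcomm : simple i * z = z * simple i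
    · refine ⟨simple i * z, comp_mul hfs hz, ?_, by omega, ?_⟩
      · rw [mul_inv_rev, simple_inv, hinv, hcomm]
      · rw [heckeLeft_of_lt (by simpa using hdesc'), simple_mul_simple_mul,
          heckeRight_of_gt hdesc]
    · have hdesc2 : (simple i * z) (hi i) < (simple i * z) (lo i) := by
        refine simple_lt_simple hdesc ?_
        rintro ⟨e1, e2⟩
        apply hcomm
        have : z * simple i * z⁻¹ = simple i := by
          rw [simple, ← swap_apply_apply, e1, e2, swap_comm]
        exact (mul_inv_eq_iff_eq_mul.1 this).symm
      have hdesc3 : (simple i * z)⁻¹⁻¹ (hi i) < (simple i * z)⁻¹⁻¹ (lo i) := by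
        rwa [inv_inv]
      have hN2 := invNum_simple_mul_of_gt hdesc3
      rw [invNum_inv, mul_inv_rev, simple_inv, hinv] at hN2
      refine ⟨simple i * (z * simple i), comp_mul hfs (comp_mul hz hfs), ?_, by omega, ?_⟩
      · rw [mul_inv_rev, mul_inv_rev, simple_inv, hinv, mul_assoc]
      · rw [heckeLeft_of_lt, simple_mul_simple_mul, heckeRight_of_lt, mul_assoc, simple_mul_self,
          mul_one]
        · simpa using hdesc
        · rw [mul_inv_rev, mul_inv_rev, simple_inv, hinv, Perm.mul_apply _ (simple i),
            Perm.mul_apply _ (simple i), simple_lo, simple_hi]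
          exact hdesc2

theorem exists_toInv_eq (hf : Monotone f) {w : Perm (Fin n)}
    (hw : (parab f w)⁻¹ = parab f w) : ∃ v, toInv f v = w := by
  obtain ⟨u, hu, hu'⟩ := exists_star_inv_eq hf _ (comp_parab hf w) hw
  refine ⟨w * (parab f w)⁻¹ * u, ?_⟩
  rw [toInv_mul hf (increasingOn_mul_parab_inv hf w) hu, hu']
  group

end ToInv

/-! ### Blocks of a composition -/

section Blocks

variable {n : ℕ}

theorem monotone_index (μ : Composition n) : Monotone μ.index := by
  intro p q hpq
  by_contra hcon
  have h1 := μ.lt_sizeUpTo_index_succ q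
  have h2 := μ.sizeUpTo_index_le p
  have h3 : μ.sizeUpTo (μ.index q).succ ≤ μ.sizeUpTo (μ.index p) :=
    μ.monotone_sizeUpTo (Nat.succ_le_of_lt (not_le.1 hcon))
  rw [Fin.le_def] at hpq
  omega

theorem Refines.index_eq {μ ν : Composition n} (h : Refines ν μ) {p q : Fin n}
    (hpq : ν.index p = ν.index q) : μ.index p = μ.index q := by
  wlog hlt : μ.index p < μ.index q generalizing p q
  · rcases lt_trichotomy (μ.index p) (μ.index q) with h' | h' | h'
    · exact absurd h' hlt
    · exact h'
    · exact (this hpq.symm h').symm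
  exfalso
  obtain ⟨k, -, hk⟩ := Finset.mem_map.1 (h (Finset.mem_map.2
    ⟨(μ.index q).castSucc, Finset.mem_univ _, rfl⟩))
  have hk' : ν.sizeUpTo k = μ.sizeUpTo (μ.index q) := congrArg Fin.val hk
  have h1 := μ.lt_sizeUpTo_index_succ p
  have h2 : μ.sizeUpTo (μ.index p).succ ≤ μ.sizeUpTo (μ.index q) :=
    μ.monotone_sizeUpTo (Nat.succ_le_of_lt hlt)
  have h3 := μ.sizeUpTo_index_le q
  have h4 := ν.sizeUpTo_index_le p
  have h5 := ν.lt_sizeUpTo_index_succ q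
  have h6 : (ν.index p : ℕ) < k := by
    by_contra hcon
    have := ν.monotone_sizeUpTo (not_lt.1 hcon)
    omega
  have h7 : (k : ℕ) < (ν.index q).succ := by
    by_contra hcon
    have := ν.monotone_sizeUpTo (not_lt.1 hcon)
    omega
  rw [hpq] at h6
  simp at h7
  omega

theorem embedding_std_eq (μ : Composition n) (π : Perm (Fin n)) {p : Fin n} {b : Fin μ.length}
    {j : Fin (μ.blocksFun b)} (h : μ.embedding b j = p) :
    μ.embedding (μ.index p) (std (block μ π (μ.index p)) (μ.invEmbedding p)) =
      μ.embedding b (std (block μ π b) j) := by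
  obtain rfl : μ.index p = b := by rw [← h, μ.index_embedding]
  have : μ.invEmbedding p = j :=
    (μ.embedding _).injective (by rw [μ.embedding_comp_inv, h])
  rw [this]

/-- For the blocks of `μ`, the parabolic part of `π` is made up of the standardizations of the
blocks of `π`. -/
theorem parab_embedding (μ : Composition n) (π : Perm (Fin n)) (b : Fin μ.length)
    (j : Fin (μ.blocksFun b)) :
    parab μ.index π (μ.embedding b j) = μ.embedding b (std (block μ π b) j) := by
  rw [← embedding_std_eq μ π rfl, ← eq_parab (f := μ.index) (w := π) (P := fun p =>
    μ.embedding (μ.index p) (std (block μ π (μ.index p)) (μ.invEmbedding p)))]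
  · intro p q hpq
    refine (monotone_index μ).reflect_lt ?_
    rwa [μ.index_embedding, μ.index_embedding]
  · intro p q hpq hlt
    obtain ⟨j', hj'⟩ : q ∈ Set.range (μ.embedding (μ.index p)) := by
      rw [Composition.mem_range_embedding_iff', hpq]
    rw [embedding_std_eq μ π hj']
    apply (μ.embedding _).strictMono
    apply std_lt_std
    unfold block
    rwa [μ.embedding_comp_inv, hj']

theorem embedding_relValue (μ : Composition n) (π : Perm (Fin n)) (k : Fin n) :
    μ.embedding (blockOf μ π k) (relValue μ π k) = parab μ.index π (π⁻¹ k) := by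
  conv_rhs => rw [← μ.embedding_comp_inv (π⁻¹ k)]
  rw [parab_embedding]
  rfl

theorem IsMuInvolution.parab_inv {μ : Composition n} {π : Perm (Fin n)}
    (h : IsMuInvolution μ π) : (parab μ.index π)⁻¹ = parab μ.index π := by
  rw [inv_eq_iff_mul_eq_one]
  ext p : 1
  rw [Perm.mul_apply, Perm.one_apply]
  conv_lhs => rw [← μ.embedding_comp_inv p]
  rw [parab_embedding, parab_embedding, h, μ.embedding_comp_inv]

theorem muAct_toInv (μ : Composition n) (v : Perm (Fin n)) (i : Fin (n - 1)) :
    muAct μ (toInv μ.index v) i = toInv μ.index (heckeLeft i v) := by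
  have hm := monotone_index μ
  have e : ∀ k, blockOf μ (toInv μ.index v) k = μ.index (v⁻¹ k) := apply_toInv_inv hm v
  unfold muAct
  split_ifs with h
  · rw [e, e] at h
    refine (toInv_heckeLeft_of_eq hm h ?_).symm
    rw [← embedding_relValue]
    rfl
  · rw [e, e] at h
    exact (toInv_heckeLeft_of_ne h).symm

end Blocks

/-! ### Words, atoms and orders -/

section Words

variable {n : ℕ}

theorem isMuWord_iff {μ : Composition n} {π : Perm (Fin n)} {a : List (Fin (n - 1))} :
    IsMuWord μ π a ↔ toInv μ.index (leftFold a 1) = π := by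
  have : a.foldl (muAct μ) 1 = toInv μ.index (leftFold a 1) := by
    induction a using List.reverseRecOn with
    | nil => exact (toInv_one (monotone_index μ)).symm
    | append_singleton a i ih =>
      rw [List.foldl_append, ih, leftFold_concat, ← muAct_toInv]
      rfl
  rw [IsMuWord, this]

theorem IsMuInvolution.exists_isReducedMuWord {μ : Composition n} {π : Perm (Fin n)}
    (h : IsMuInvolution μ π) : ∃ a, IsReducedMuWord μ π a := by
  obtain ⟨v, hv⟩ := exists_toInv_eq (monotone_index μ) h.parab_inv
  obtain ⟨a, ha, -⟩ := exists_leftFold v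
  obtain ⟨b, hb, hmin⟩ := (measure List.length).wf.has_min {b | IsMuWord μ π b}
    ⟨a, isMuWord_iff.2 (by rw [ha, hv])⟩
  exact ⟨b, hb, fun c hc => not_lt.1 (hmin c hc)⟩

/-- A reduced `μ`-word is a reduced word: otherwise a reduced word of its 0-Hecke product would be
a shorter `μ`-word. -/
theorem IsReducedMuWord.isReducedWord {μ : Composition n} {π : Perm (Fin n)}
    {a : List (Fin (n - 1))} (h : IsReducedMuWord μ π a) : IsReducedWord (wordProd a) a := by
  obtain ⟨b, hb, hlen, -⟩ := exists_leftFold (leftFold a 1)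
  have hle := h.2 b (isMuWord_iff.2 (by rw [hb]; exact isMuWord_iff.1 h.1))
  have heq : invNum (leftFold a 1) = a.length := le_antisymm (invNum_leftFold_le a) (hlen ▸ hle)
  exact isReducedWord_iff.2 ⟨rfl, by rw [← leftFold_of_invNum_eq heq, heq]⟩

theorem IsReducedMuWord.mem_atoms {μ : Composition n} {π : Perm (Fin n)}
    {a : List (Fin (n - 1))} (h : IsReducedMuWord μ π a) : wordProd a ∈ atoms μ π :=
  ⟨a, h.isReducedWord, h⟩

theorem IsReducedWord.length_eq {w : Perm (Fin n)} {a b : List (Fin (n - 1))}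
    (ha : IsReducedWord w a) (hb : IsReducedWord w b) : a.length = b.length :=
  le_antisymm (ha.2 b hb.1) (hb.2 a ha.1)

theorem IsReducedMuWord.length_eq {μ : Composition n} {π : Perm (Fin n)}
    {a b : List (Fin (n - 1))} (ha : IsReducedMuWord μ π a) (hb : IsReducedMuWord μ π b) :
    a.length = b.length :=
  le_antisymm (ha.2 b hb.1) (hb.2 a ha.1)

theorem atoms_subset_of_mem {μ ν : Composition n} (hνμ : Refines ν μ) {π τ w : Perm (Fin n)}
    (h1 : w ∈ atoms ν τ) (h2 : w ∈ atoms μ π) : atoms ν τ ⊆ atoms μ π := by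
  obtain ⟨a, haw, ha⟩ := h1
  obtain ⟨b, hbw, hb⟩ := h2
  rintro w' ⟨c, hcw, hc⟩
  refine ⟨c, hcw, isMuWord_iff.2 ?_, fun d hd => ?_⟩
  · rw [← isMuWord_iff.1 hb.1, hbw.leftFold_eq, ← haw.leftFold_eq]
    exact toInv_eq_of_toInv_eq (monotone_index μ) (monotone_index ν) (fun p q => hνμ.index_eq)
      ((isMuWord_iff.1 hc.1).trans (isMuWord_iff.1 ha.1).symm)
  · rw [hc.length_eq ha, haw.length_eq hbw]
    exact hb.2 d hd

/-- The length of the reduced words of a `μ`-involution. -/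
noncomputable def rank (x : MuInvolution n) : ℕ :=
  x.isMuInvolution.exists_isReducedMuWord.choose.length

theorem IsReducedMuWord.length_eq_rank {x : MuInvolution n} {a : List (Fin (n - 1))}
    (h : IsReducedMuWord x.comp x.perm a) : a.length = rank x :=
  h.length_eq x.isMuInvolution.exists_isReducedMuWord.choose_spec

theorem rank_eq_of_mem_atoms {x y : MuInvolution n} {w : Perm (Fin n)}
    (hx : w ∈ atoms x.comp x.perm) (hy : w ∈ atoms y.comp y.perm) : rank x = rank y := by
  obtain ⟨a, haw, ha⟩ := hx
  obtain ⟨b, hbw, hb⟩ := hy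
  rw [← ha.length_eq_rank, ← hb.length_eq_rank, haw.length_eq hbw]

theorem CrossStep.rank_eq {x y : MuInvolution n} (h : CrossStep x y) : rank x = rank y := by
  obtain ⟨a, ha⟩ := x.isMuInvolution.exists_isReducedMuWord
  exact rank_eq_of_mem_atoms ha.mem_atoms (h.2.2 ha.mem_atoms)

theorem rank_le_of_bruhatLE {x y : MuInvolution n} (hc : x.comp = y.comp)
    (h : BruhatLE y.comp x.perm y.perm) : rank x ≤ rank y ∧ (rank x = rank y → x = y) := by
  obtain ⟨a, ha⟩ := y.isMuInvolution.exists_isReducedMuWord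
  obtain ⟨b, hsub, hb⟩ := h a ha
  have hb' : IsReducedMuWord x.comp x.perm b := by rwa [hc]
  rw [← ha.length_eq_rank, ← hb'.length_eq_rank]
  refine ⟨hsub.length_le, fun hlen => ?_⟩
  obtain rfl := hsub.eq_of_length hlen
  have hperm : x.perm = y.perm := hb.1.symm.trans ha.1
  cases x
  cases y
  cases hc
  cases hperm
  rfl

/-- In the order generated by `s`, suppose that `r` is weakly increasing and `l` weakly decreasing
along `s`, and that together they separate comparable elements. Then a relation of `s` that keeps
`r` and lowers `l` by one is a cover relation. -/
theorem isCover_reflTransGen {α κ : Type*} [PartialOrder κ] {s : α → α → Prop} {r : α → κ}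
    {l : α → ℕ} (hs : ∀ x y, s x y → r x ≤ r y ∧ l y ≤ l x ∧ (r x = r y → l x = l y → x = y))
    {x y : α} (hxy : s x y) (hr : r x = r y) (hl : l x = l y + 1) :
    IsCover (Relation.ReflTransGen s) x y := by
  have H : ∀ x y, Relation.ReflTransGen s x y →
      r x ≤ r y ∧ l y ≤ l x ∧ (r x = r y → l x = l y → x = y) := by
    intro x y h
    induction h with
    | refl => exact ⟨le_rfl, le_rfl, fun _ _ => rfl⟩
    | @tail b c _ hbc ih =>
      obtain ⟨h1, h2, h3⟩ := ih
      obtain ⟨h4, h5, h6⟩ := hs b c hbc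
      refine ⟨h1.trans h4, h5.trans h2, fun hr hl => ?_⟩
      have e1 : r x = r b := le_antisymm h1 (hr ▸ h4)
      have e2 : l x = l b := by omega
      rw [h3 e1 e2]
      exact h6 (e1 ▸ hr) (e2 ▸ hl)
  refine ⟨Relation.ReflTransGen.single hxy, ?_, fun z hxz hzy => ?_⟩
  · rintro rfl
    omega
  · obtain ⟨h1, h2, h3⟩ := H x z hxz
    obtain ⟨h4, h5, h6⟩ := H z y hzy
    have e1 : r x = r z := le_antisymm h1 (hr ▸ h4)
    have e2 : r z = r y := e1.symm.trans hr
    by_cases hz : l x = l z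
    · exact Or.inl (h3 e1 hz).symm
    · exact Or.inr (h6 e2 (by omega))

theorem CrossStep.isCover_muBruhatLE {x y : MuInvolution n} (h : CrossStep x y) :
    IsCover MuBruhatLE x y := by
  refine isCover_reflTransGen (r := rank) (l := fun x => x.comp.length) ?_ (Or.inr h) h.rank_eq
    h.2.1
  rintro x y (⟨hc, hle⟩ | hcross)
  · have := rank_le_of_bruhatLE hc hle
    exact ⟨this.1, by rw [hc], fun hr _ => this.2 hr⟩
  · refine ⟨hcross.rank_eq.le, ?_, fun _ hl => ?_⟩ <;> have := hcross.2.1 <;> omega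

theorem CrossStep.isCover_closureLE {x y : MuInvolution n} (h : CrossStep x y) :
    IsCover ClosureLE x y := by
  refine isCover_reflTransGen (r := fun x => OrderDual.toDual (rank x))
    (l := fun x => x.comp.length) ?_ (Or.inr h) (congrArg _ h.rank_eq) h.2.1
  rintro x y (⟨hc, hle⟩ | hcross)
  · have := rank_le_of_bruhatLE hc.symm (by rwa [hc])
    exact ⟨this.1, by rw [hc], fun hr _ => (this.2 (OrderDual.toDual.injective hr).symm).symm⟩
  · refine ⟨hcross.rank_eq.ge, ?_, fun _ hl => ?_⟩ <;> have := hcross.2.1 <;> omega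

end Words

end MuInv

theorem lemma3p5 {n : ℕ} (μ ν : Composition n) (hνμ : MuInv.Refines ν μ)
    (π τ : Equiv.Perm (Fin n))
    (hπ : MuInv.IsMuInvolution μ π) (hτ : MuInv.IsMuInvolution ν τ) :
    (MuInv.invAtoms ν τ ⊆ MuInv.invAtoms μ π ∨
      MuInv.invAtoms ν τ ∩ MuInv.invAtoms μ π = ∅) ∧
    (ν.length = μ.length + 1 → (∃ w ∈ MuInv.atoms ν τ, w ∈ MuInv.atoms μ π) →
      MuInv.IsCover MuInv.MuBruhatLE ⟨ν, τ, hτ⟩ ⟨μ, π, hπ⟩ ∧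
      MuInv.IsCover MuInv.ClosureLE ⟨ν, τ, hτ⟩ ⟨μ, π, hπ⟩) := by
  constructor
  · rcases (MuInv.invAtoms ν τ ∩ MuInv.invAtoms μ π).eq_empty_or_nonempty with h | ⟨v, h1, h2⟩
    · exact Or.inr h
    · exact Or.inl fun v' hv' => MuInv.atoms_subset_of_mem hνμ h1 h2 hv'
  · rintro hlen ⟨w, h1, h2⟩
    have h : MuInv.CrossStep ⟨ν, τ, hτ⟩ ⟨μ, π, hπ⟩ :=
      ⟨hνμ, hlen, MuInv.atoms_subset_of_mem hνμ h1 h2⟩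
    exact ⟨h.isCover_muBruhatLE, h.isCover_closureLE⟩
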